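/- Let $\mathbb{C}_+=\{w\in\mathbb{C}:\operatorname{Re}(w)>0\}$ and let $H^2(\mathbb{C}_+)$ be the Hilbert space of all holomorphic functions $f$ on $\mathbb{C}_+$ with $$\|f\|=\Big(\sup_{0<x<\infty}\frac1\pi\int_{-\infty}^{\infty}|f(x+iy)|^2\,dy\Big)^{1/2}<\infty .$$ A bounded operator $T$ on a complex Hilbert space $\mathcal H$ is called cohyponormal if $\|Tx\|\le\|T^*x\|$ for all $x\in\mathcal H$. Let $a>0$ be real, let $b\in\mathbb{C}$ with $\operatorname{Re}(b)\ge 0$, and let $\phi$ be the self-map $\phi(w)=aw+b$ of $\mathbb{C}_+$. Then the composition operator $C_\phi f=f\circ\phi$ is a bounded operator on $H^2(\mathbb{C}_+)$, and $C_\phi$ is cohyponormal if and only if $a\ge 1$ or $\operatorname{Re}(b)=0$. -/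

import Mathlib

open scoped ENNReal NNReal

noncomputable section

namespace HalfPlane

/-- The open right half-plane `ℂ₊ = {z : Re z > 0}`. -/
def RightHalfPlane : Set ℂ := {z | 0 < z.re}

/-- Extension by zero to `ℂ` of a function on the right half-plane. It is only ever evaluated or
differentiated at points of the (open) right half-plane. -/
def zeroExt (f : RightHalfPlane → ℂ) : ℂ → ℂ :=
  Function.extend ((↑) : RightHalfPlane → ℂ) f 0

/-- `f` is holomorphic on the right half-plane. -/
def IsHolomorphic (f : RightHalfPlane → ℂ) : Prop :=
  DifferentiableOn ℂ (zeroExt f) RightHalfPlane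

/-- `∫ |F (x + i y)|² dy`, as an element of `[0, ∞]`. -/
def lineSq (F : ℂ → ℂ) (x : ℝ) : ℝ≥0∞ :=
  ∫⁻ y : ℝ, ‖F (x + y * Complex.I)‖ₑ ^ 2

/-- The square of the Hardy norm, `sup_{0 < x < ∞} (1/π) ∫ |f (x + i y)|² dy`, in `[0, ∞]`. -/
def hardySq (f : RightHalfPlane → ℂ) : ℝ≥0∞ :=
  ⨆ x : Set.Ioi (0 : ℝ), ENNReal.ofReal (1 / Real.pi) * lineSq (zeroExt f) x

/-! Elementary facts -/

lemma isOpen_rightHalfPlane : IsOpen RightHalfPlane :=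
  isOpen_lt continuous_const Complex.continuous_re

lemma zeroExt_apply (f : RightHalfPlane → ℂ) (w : RightHalfPlane) : zeroExt f w = f w :=
  Subtype.val_injective.extend_apply f 0 w

lemma zeroExt_of_mem (f : RightHalfPlane → ℂ) {z : ℂ} (hz : z ∈ RightHalfPlane) :
    zeroExt f z = f ⟨z, hz⟩ :=
  zeroExt_apply f ⟨z, hz⟩

lemma zeroExt_of_notMem (f : RightHalfPlane → ℂ) {z : ℂ} (hz : z ∉ RightHalfPlane) :
    zeroExt f z = 0 := by
  unfold zeroExt
  rw [Function.extend_apply']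
  · rfl
  · rintro ⟨a, rfl⟩
    exact hz a.2

lemma zeroExt_zero : zeroExt 0 = 0 := by
  funext z
  by_cases hz : z ∈ RightHalfPlane
  · simp [zeroExt_of_mem _ hz]
  · simp [zeroExt_of_notMem _ hz]

lemma zeroExt_add (f g : RightHalfPlane → ℂ) : zeroExt (f + g) = zeroExt f + zeroExt g := by
  funext z
  by_cases hz : z ∈ RightHalfPlane
  · simp [zeroExt_of_mem _ hz]
  · simp [zeroExt_of_notMem _ hz]

lemma zeroExt_smul (c : ℂ) (f : RightHalfPlane → ℂ) : zeroExt (c • f) = c • zeroExt f := by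
  funext z
  by_cases hz : z ∈ RightHalfPlane
  · simp [zeroExt_of_mem _ hz]
  · simp [zeroExt_of_notMem _ hz]

lemma zeroExt_sub (f g : RightHalfPlane → ℂ) : zeroExt (f - g) = zeroExt f - zeroExt g := by
  funext z
  by_cases hz : z ∈ RightHalfPlane
  · simp [zeroExt_of_mem _ hz]
  · simp [zeroExt_of_notMem _ hz]

lemma mem_rhp {x : ℝ} (hx : 0 < x) (y : ℝ) : (x + y * Complex.I : ℂ) ∈ RightHalfPlane := by
  simpa [RightHalfPlane] using hx

lemma continuous_line {F : ℂ → ℂ} (hF : DifferentiableOn ℂ F RightHalfPlane) {x : ℝ}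
    (hx : 0 < x) : Continuous fun y : ℝ => F (x + y * Complex.I) :=
  hF.continuousOn.comp_continuous (by fun_prop) fun y => mem_rhp hx y

lemma lineSq_eq {F : ℂ → ℂ} (x : ℝ) :
    lineSq F x = MeasureTheory.eLpNorm (fun y : ℝ => F (x + y * Complex.I)) 2 MeasureTheory.volume ^ 2 := by
  rw [MeasureTheory.eLpNorm_eq_lintegral_rpow_enorm_toReal (by norm_num) (by norm_num)]
  rw [← ENNReal.rpow_natCast, ← ENNReal.rpow_mul]
  simp [lineSq]

lemma inv_pi_ne_zero : ENNReal.ofReal (1 / Real.pi) ≠ 0 := by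
  simp [Real.pi_pos]

/-- Bound of the line integrals by the Hardy norm. -/
lemma lineSq_le (f : RightHalfPlane → ℂ) {x : ℝ} (hx : 0 < x) :
    lineSq (zeroExt f) x ≤ ENNReal.ofReal Real.pi * hardySq f := by
  have h : ENNReal.ofReal (1 / Real.pi) * lineSq (zeroExt f) x ≤ hardySq f :=
    le_iSup (fun x : Set.Ioi (0 : ℝ) => ENNReal.ofReal (1 / Real.pi) * lineSq (zeroExt f) x) ⟨x, hx⟩
  have h2 : ENNReal.ofReal Real.pi * ENNReal.ofReal (1 / Real.pi) = 1 := by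
    rw [← ENNReal.ofReal_mul Real.pi_pos.le, mul_one_div_cancel Real.pi_ne_zero, ENNReal.ofReal_one]
  calc lineSq (zeroExt f) x
      = ENNReal.ofReal Real.pi * (ENNReal.ofReal (1 / Real.pi) * lineSq (zeroExt f) x) := by
        rw [← mul_assoc, h2, one_mul]
    _ ≤ _ := by gcongr

lemma hardySq_zero : hardySq 0 = 0 := by
  simp [hardySq, zeroExt_zero, lineSq]

lemma hardySq_smul (c : ℂ) (f : RightHalfPlane → ℂ) :
    hardySq (c • f) = ‖c‖ₑ ^ 2 * hardySq f := by
  have h : ∀ x, lineSq (zeroExt (c • f)) x = ‖c‖ₑ ^ 2 * lineSq (zeroExt f) x := by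
    intro x
    rw [lineSq, lineSq, ← MeasureTheory.lintegral_const_mul' _ _ (by simp)]
    simp [zeroExt_smul, enorm_mul, mul_pow]
  unfold hardySq
  rw [ENNReal.mul_iSup]
  refine iSup_congr fun x => ?_
  rw [h, mul_left_comm]

lemma hardySq_rpow_add_le {f g : RightHalfPlane → ℂ} (hf : IsHolomorphic f)
    (hg : IsHolomorphic g) :
    hardySq (f + g) ^ (1 / 2 : ℝ) ≤ hardySq f ^ (1 / 2 : ℝ) + hardySq g ^ (1 / 2 : ℝ) := by
  have key : ∀ a : ℝ≥0∞, (a ^ 2) ^ (1 / 2 : ℝ) = a := by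
    intro a
    rw [← ENNReal.rpow_natCast, ← ENNReal.rpow_mul]
    simp
  have hle : ∀ (h : RightHalfPlane → ℂ) (x : Set.Ioi (0 : ℝ)),
      ENNReal.ofReal (1 / Real.pi) ^ (1 / 2 : ℝ) *
        MeasureTheory.eLpNorm (fun y : ℝ => zeroExt h (x + y * Complex.I)) 2 MeasureTheory.volume ≤
      hardySq h ^ (1 / 2 : ℝ) := by
    intro h x
    have := le_iSup (fun x : Set.Ioi (0 : ℝ) =>
      ENNReal.ofReal (1 / Real.pi) * lineSq (zeroExt h) x) x
    have h2 := ENNReal.rpow_le_rpow this (z := 1 / 2) (by norm_num)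
    rw [lineSq_eq, ENNReal.mul_rpow_of_nonneg _ _ (by norm_num), key] at h2
    exact h2
  have hsq : hardySq (f + g) ≤
      (hardySq f ^ (1 / 2 : ℝ) + hardySq g ^ (1 / 2 : ℝ)) ^ (2 : ℝ) := by
    refine iSup_le fun x => ?_
    have hx : (0 : ℝ) < x := x.2
    have tri := MeasureTheory.eLpNorm_add_le (μ := MeasureTheory.volume) (p := 2)
      (continuous_line hf hx).aestronglyMeasurable
      (continuous_line hg hx).aestronglyMeasurable (by norm_num)
    have e : ENNReal.ofReal (1 / Real.pi) * lineSq (zeroExt (f + g)) x =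
        (ENNReal.ofReal (1 / Real.pi) ^ (1 / 2 : ℝ) *
          MeasureTheory.eLpNorm (fun y : ℝ => zeroExt (f + g) (x + y * Complex.I)) 2
            MeasureTheory.volume) ^ (2 : ℝ) := by
      rw [lineSq_eq, ENNReal.mul_rpow_of_nonneg _ _ (by norm_num), ← ENNReal.rpow_mul]
      simp
    rw [e]
    refine ENNReal.rpow_le_rpow ?_ (by norm_num)
    calc _ ≤ ENNReal.ofReal (1 / Real.pi) ^ (1 / 2 : ℝ) *
          (MeasureTheory.eLpNorm (fun y : ℝ => zeroExt f (x + y * Complex.I)) 2 MeasureTheory.volume +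
          MeasureTheory.eLpNorm (fun y : ℝ => zeroExt g (x + y * Complex.I)) 2 MeasureTheory.volume) := by
            gcongr
            rw [zeroExt_add]
            exact tri
      _ ≤ _ := by
        rw [mul_add]
        exact add_le_add (hle f x) (hle g x)
  have := ENNReal.rpow_le_rpow hsq (z := 1 / 2) (by norm_num)
  rwa [← ENNReal.rpow_mul, show (2 : ℝ) * (1 / 2) = 1 by norm_num, ENNReal.rpow_one] at this

/-- The vector space `{f ∈ H(ℂ₊) : ‖f‖ < ∞}`. -/
def hardySubmodule : Submodule ℂ (RightHalfPlane → ℂ) where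
  carrier := {f | IsHolomorphic f ∧ hardySq f < ∞}
  zero_mem' := by
    refine ⟨?_, by simp [hardySq_zero]⟩
    rw [IsHolomorphic, zeroExt_zero]
    exact differentiableOn_const 0
  add_mem' := by
    rintro f g ⟨hf, hf'⟩ ⟨hg, hg'⟩
    refine ⟨?_, ?_⟩
    · rw [IsHolomorphic, zeroExt_add]
      exact hf.add hg
    · have h := hardySq_rpow_add_le hf hg
      have h1 : hardySq f ^ (1 / 2 : ℝ) < ∞ := ENNReal.rpow_lt_top_of_nonneg (by norm_num) hf'.ne
      have h2 : hardySq g ^ (1 / 2 : ℝ) < ∞ := ENNReal.rpow_lt_top_of_nonneg (by norm_num) hg'.ne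
      have h3 := h.trans_lt (ENNReal.add_lt_top.2 ⟨h1, h2⟩)
      exact (ENNReal.rpow_lt_top_iff_of_pos (by norm_num)).1 h3
  smul_mem' := by
    rintro c f ⟨hf, hf'⟩
    refine ⟨?_, ?_⟩
    · rw [IsHolomorphic, zeroExt_smul]
      exact hf.const_smul c
    · rw [hardySq_smul]
      exact ENNReal.mul_lt_top (by simp) hf'

/-- The Hardy space `H²(ℂ₊)` of the right half-plane. -/
def HardyH2 : Type := hardySubmodule

namespace HardyH2

instance : AddCommGroup HardyH2 := inferInstanceAs (AddCommGroup hardySubmodule)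

instance : Module ℂ HardyH2 := inferInstanceAs (Module ℂ hardySubmodule)

/-- The function on `ℂ₊` that an element of `H²(ℂ₊)` is. -/
def toFun (f : HardyH2) : RightHalfPlane → ℂ := Subtype.val (p := (· ∈ hardySubmodule)) f

instance : CoeFun HardyH2 fun _ => RightHalfPlane → ℂ := ⟨toFun⟩

lemma toFun_injective {f g : HardyH2} (h : f.toFun = g.toFun) : f = g := Subtype.ext h

lemma coe_add (f g : HardyH2) : (f + g).toFun = f.toFun + g.toFun := rfl
lemma coe_sub (f g : HardyH2) : (f - g).toFun = f.toFun - g.toFun := rfl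
lemma coe_smul (c : ℂ) (f : HardyH2) : (c • f).toFun = c • f.toFun := rfl
lemma coe_zero : (0 : HardyH2).toFun = 0 := rfl

lemma hol (f : HardyH2) : DifferentiableOn ℂ (zeroExt f.toFun) RightHalfPlane :=
  (Subtype.property (p := (· ∈ hardySubmodule)) f).1

lemma hardySq_ne_top (f : HardyH2) : hardySq f.toFun ≠ ∞ := (Subtype.property (p := (· ∈ hardySubmodule)) f).2.ne

/-- The Hardy norm `‖f‖ = (sup_{0 < x < ∞} (1/π) ∫ |f (x + i y)|² dy)^(1/2)`. -/
instance : Norm HardyH2 := ⟨fun f => Real.sqrt (hardySq f.toFun).toReal⟩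

lemma norm_def (f : HardyH2) : ‖f‖ = Real.sqrt (hardySq f.toFun).toReal := rfl

lemma norm_mul_self (f : HardyH2) : ‖f‖ * ‖f‖ = (hardySq f.toFun).toReal :=
  Real.mul_self_sqrt ENNReal.toReal_nonneg

lemma norm_eq_rpow (f : HardyH2) : ‖f‖ = (hardySq f.toFun ^ (1 / 2 : ℝ)).toReal := by
  rw [norm_def, Real.sqrt_eq_rpow, ENNReal.toReal_rpow]

lemma hardySq_eq (f : HardyH2) : hardySq f.toFun = ENNReal.ofReal (‖f‖ * ‖f‖) := by
  rw [norm_mul_self, ENNReal.ofReal_toReal f.hardySq_ne_top]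

lemma eq_zero_of_hardySq {f : HardyH2} (h : hardySq f.toFun = 0) : f = 0 := by
  apply toFun_injective
  funext w
  have hw : 0 < w.1.re := w.2
  have hc := continuous_line f.hol hw
  have h0 : lineSq (zeroExt f.toFun) w.1.re = 0 := by
    have := lineSq_le f.toFun hw
    rw [h, mul_zero] at this
    exact le_antisymm this bot_le
  rw [lineSq, MeasureTheory.lintegral_eq_zero_iff (hc.measurable.enorm.pow_const 2)] at h0
  have h1 : (fun y : ℝ => zeroExt f.toFun (w.1.re + y * Complex.I)) =ᵐ[MeasureTheory.volume]
      fun _ => 0 := by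
    filter_upwards [h0] with y hy
    simpa using hy
  have h2 := congrFun (MeasureTheory.Measure.eq_of_ae_eq h1 hc continuous_const) w.1.im
  simp only [Complex.re_add_im, zeroExt_apply] at h2
  exact h2

lemma normCore : NormedSpace.Core ℂ HardyH2 where
  norm_nonneg f := Real.sqrt_nonneg _
  norm_smul c f := by
    rw [norm_def, norm_def, coe_smul, hardySq_smul, ENNReal.toReal_mul,
      Real.sqrt_mul ENNReal.toReal_nonneg]
    simp
  norm_triangle f g := by
    have h1 : hardySq f.toFun ^ (1 / 2 : ℝ) ≠ ∞ :=
      (ENNReal.rpow_lt_top_of_nonneg (by norm_num) f.hardySq_ne_top).ne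
    have h2 : hardySq g.toFun ^ (1 / 2 : ℝ) ≠ ∞ :=
      (ENNReal.rpow_lt_top_of_nonneg (by norm_num) g.hardySq_ne_top).ne
    rw [norm_eq_rpow, norm_eq_rpow, norm_eq_rpow, coe_add, ← ENNReal.toReal_add h1 h2]
    exact ENNReal.toReal_mono (ENNReal.add_ne_top.2 ⟨h1, h2⟩) (hardySq_rpow_add_le f.hol g.hol)
  norm_eq_zero_iff f := by
    constructor
    · intro h
      rw [norm_def, Real.sqrt_eq_zero ENNReal.toReal_nonneg, ENNReal.toReal_eq_zero_iff] at h
      exact eq_zero_of_hardySq (h.resolve_right f.hardySq_ne_top)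
    · rintro rfl
      rw [norm_def, coe_zero, hardySq_zero]
      simp

instance : NormedAddCommGroup HardyH2 := NormedAddCommGroup.ofCore normCore

instance : NormedSpace ℂ HardyH2 := NormedSpace.ofCore normCore

end HardyH2

/-! The line integrals decrease with the distance from the boundary -/

/-- Pairing with a test function on a bounded interval of the vertical line. -/
def pairing (F : ℂ → ℂ) (g : ℝ → ℂ) (R : ℝ) (z : ℂ) : ℂ :=
  ∫ y in (-R)..R, F (z + y * Complex.I) * g y

lemma shift_mem {z : ℂ} (hz : z ∈ RightHalfPlane) (y : ℝ) :
    z + y * Complex.I ∈ RightHalfPlane := by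
  simpa [RightHalfPlane] using hz

lemma pairing_differentiableOn {F : ℂ → ℂ} (hF : DifferentiableOn ℂ F RightHalfPlane)
    {g : ℝ → ℂ} (hg : Continuous g) (R : ℝ) :
    DifferentiableOn ℂ (pairing F g R) RightHalfPlane := by
  intro z₀ hz₀
  have hd : DifferentiableOn ℂ (deriv F) RightHalfPlane := hF.deriv isOpen_rightHalfPlane
  obtain ⟨ε, hε, hball⟩ := Metric.nhds_basis_closedBall.mem_iff.1
    (isOpen_rightHalfPlane.mem_nhds hz₀)
  have hcont : ∀ G : ℂ → ℂ, DifferentiableOn ℂ G RightHalfPlane → ∀ z ∈ RightHalfPlane,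
      Continuous fun y : ℝ => G (z + y * Complex.I) * g y := by
    intro G hG z hz
    exact (hG.continuousOn.comp_continuous (by fun_prop) fun y => shift_mem hz y).mul hg
  have hK : IsCompact (Metric.closedBall z₀ ε ×ˢ Set.uIcc (-R) R) :=
    (isCompact_closedBall z₀ ε).prod isCompact_uIcc
  obtain ⟨C, hC⟩ := hK.exists_bound_of_continuousOn
    (f := fun p : ℂ × ℝ => deriv F (p.1 + p.2 * Complex.I) * g p.2) (by
      refine ContinuousOn.mul (hd.continuousOn.comp (by fun_prop) ?_) (by fun_prop)
      rintro ⟨z, y⟩ ⟨hz, -⟩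
      exact shift_mem (hball hz) y)
  have := intervalIntegral.hasDerivAt_integral_of_dominated_loc_of_deriv_le
    (μ := MeasureTheory.volume) (a := -R) (b := R) (bound := fun _ => C)
    (F := fun (z : ℂ) (y : ℝ) => F (z + y * Complex.I) * g y)
    (F' := fun (z : ℂ) (y : ℝ) => deriv F (z + y * Complex.I) * g y) (x₀ := z₀)
    (Metric.closedBall_mem_nhds z₀ hε)
    (by
      filter_upwards [isOpen_rightHalfPlane.mem_nhds hz₀] with z hz
      exact (hcont F hF z hz).aestronglyMeasurable)
    ((hcont F hF z₀ hz₀).intervalIntegrable _ _)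
    (hcont _ hd z₀ hz₀).aestronglyMeasurable
    (Filter.Eventually.of_forall fun y hy z hz => hC (z, y) ⟨hz, Set.uIoc_subset_uIcc hy⟩)
    intervalIntegrable_const
    (Filter.Eventually.of_forall fun y _ z hz => by
      have h1 := (hF.differentiableAt (isOpen_rightHalfPlane.mem_nhds
        (shift_mem (hball hz) y))).hasDerivAt
      exact (h1.comp_add_const z (y * Complex.I)).mul_const (g y))
  exact this.2.differentiableAt.differentiableWithinAt

lemma lintegral_shift (F : ℂ → ℂ) (z : ℂ) :
    ∫⁻ y : ℝ, ‖F (z + y * Complex.I)‖ₑ ^ 2 = lineSq F z.re := by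
  rw [lineSq, ← MeasureTheory.lintegral_add_left_eq_self
    (fun y : ℝ => ‖F (z.re + y * Complex.I)‖ₑ ^ 2) z.im]
  refine MeasureTheory.lintegral_congr fun y => ?_
  congr 3
  apply Complex.ext <;> simp

lemma pairing_enorm_le {F : ℂ → ℂ} (hF : DifferentiableOn ℂ F RightHalfPlane)
    {g : ℝ → ℂ} (hg : Continuous g) {R : ℝ} (hR : 0 ≤ R) {z : ℂ} (hz : z ∈ RightHalfPlane) :
    ‖pairing F g R z‖ₑ ≤ lineSq F z.re ^ (1 / 2 : ℝ) *
      (∫⁻ y in Set.Ioc (-R) R, ‖g y‖ₑ ^ 2) ^ (1 / 2 : ℝ) := by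
  have hc : Continuous fun y : ℝ => F (z + y * Complex.I) :=
    hF.continuousOn.comp_continuous (by fun_prop) fun y => shift_mem hz y
  rw [pairing, intervalIntegral.integral_of_le (by linarith)]
  refine (MeasureTheory.enorm_integral_le_lintegral_enorm _).trans ?_
  simp_rw [enorm_mul]
  refine (ENNReal.lintegral_mul_le_Lp_mul_Lq (MeasureTheory.volume.restrict (Set.Ioc (-R) R))
    Real.HolderConjugate.two_two hc.measurable.enorm.aemeasurable
    hg.measurable.enorm.aemeasurable).trans ?_
  simp only [ENNReal.rpow_two]
  gcongr
  rw [← lintegral_shift F z]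
  exact MeasureTheory.setLIntegral_le_lintegral _ _

lemma lineSq_antitone {F : ℂ → ℂ} (hF : DifferentiableOn ℂ F RightHalfPlane)
    {K : ℝ≥0∞} (hK : K ≠ ∞) (hb : ∀ x : ℝ, 0 < x → lineSq F x ≤ K)
    {x₀ x₁ : ℝ} (h₀ : 0 < x₀) (h : x₀ ≤ x₁) : lineSq F x₁ ≤ lineSq F x₀ := by
  have h₁ : 0 < x₁ := h₀.trans_le h
  have hc₁ := continuous_line hF h₁
  -- truncated estimate
  have key : ∀ n : ℕ, ∫⁻ y in Set.Ioc (-(n : ℝ)) n, ‖F (x₁ + y * Complex.I)‖ₑ ^ 2 ≤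
      lineSq F x₀ := by
    intro n
    set g : ℝ → ℂ := fun y => (starRingEnd ℂ) (F (x₁ + y * Complex.I)) with hgdef
    have hg : Continuous g := Complex.continuous_conj.comp hc₁
    set A : ℝ≥0∞ := ∫⁻ y in Set.Ioc (-(n : ℝ)) n, ‖F (x₁ + y * Complex.I)‖ₑ ^ 2 with hA
    have hgA : ∫⁻ y in Set.Ioc (-(n : ℝ)) n, ‖g y‖ₑ ^ 2 = A := by
      refine MeasureTheory.lintegral_congr fun y => ?_
      congr 1
      rw [hgdef, ← ofReal_norm, ← ofReal_norm, Complex.norm_conj]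
    have hAK : A ≤ K := (MeasureTheory.setLIntegral_le_lintegral _ _).trans (hb x₁ h₁)
    have hAtop : A ≠ ∞ := ne_top_of_le_ne_top hK hAK
    have hL : ∀ x : ℝ, 0 < x → lineSq F x ≠ ∞ := fun x hx => ne_top_of_le_ne_top hK (hb x hx)
    have half_ne : ∀ a : ℝ≥0∞, a ≠ ∞ → a ^ (1 / 2 : ℝ) ≠ ∞ := fun a ha =>
      (ENNReal.rpow_lt_top_of_nonneg (by norm_num) ha).ne
    have hnorm : ∀ (B : ℝ≥0∞), B ≠ ∞ → ∀ z ∈ RightHalfPlane, lineSq F z.re ≤ B →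
        ‖pairing F g n z‖ ≤ (B ^ (1 / 2 : ℝ) * A ^ (1 / 2 : ℝ)).toReal := by
      intro B hB z hz hzB
      have := pairing_enorm_le hF hg (Nat.cast_nonneg n) hz
      rw [hgA] at this
      rw [← toReal_enorm]
      refine ENNReal.toReal_mono (ENNReal.mul_ne_top (half_ne B hB) (half_ne A hAtop))
        (this.trans ?_)
      gcongr
    have hmaps : ∀ z : ℂ, 0 ≤ z.re → (x₀ : ℂ) + z ∈ RightHalfPlane := by
      intro z hz
      simp only [RightHalfPlane, Set.mem_ofPred_eq, Complex.add_re, Complex.ofReal_re]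
      linarith
    have hdiff := pairing_differentiableOn hF hg (n : ℝ)
    have hPL := PhragmenLindelof.right_half_plane_of_bounded_on_real
      (f := fun z => pairing F g n (x₀ + z))
      (C := ((lineSq F x₀) ^ (1 / 2 : ℝ) * A ^ (1 / 2 : ℝ)).toReal) (z := (x₁ : ℂ) - x₀)
      (by
        apply DifferentiableOn.diffContOnCl
        refine hdiff.comp (by fun_prop) ?_
        intro z hz
        apply hmaps
        have : closure {z : ℂ | 0 < z.re} ⊆ {z : ℂ | 0 ≤ z.re} :=
          closure_minimal (fun z (hz : 0 < z.re) => hz.le)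
            (isClosed_le continuous_const Complex.continuous_re)
        exact this hz)
      ⟨1, by norm_num, 0, by
        refine Asymptotics.IsBigO.of_bound (K ^ (1 / 2 : ℝ) * A ^ (1 / 2 : ℝ)).toReal ?_
        refine Filter.Eventually.filter_mono inf_le_right ?_
        refine Filter.eventually_principal.2 fun z (hz : 0 < z.re) => ?_
        have hm := hmaps z hz.le
        simpa using hnorm K hK _ hm (hb _ hm)⟩
      ⟨(K ^ (1 / 2 : ℝ) * A ^ (1 / 2 : ℝ)).toReal, by
        rw [Filter.eventually_map]
        filter_upwards [Filter.eventually_ge_atTop 0] with x hx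
        have hm := hmaps x (by simpa using hx)
        exact hnorm K hK _ hm (hb _ hm)⟩
      (by
        intro x
        have hm := hmaps (x * Complex.I) (by simp)
        exact hnorm _ (hL x₀ h₀) _ hm (by simp))
      (by simpa using h)
    have hval : pairing F g n (x₀ + ((x₁ : ℂ) - x₀)) = (A.toReal : ℂ) := by
      rw [add_sub_cancel, pairing, intervalIntegral.integral_of_le (by
        have : (0 : ℝ) ≤ n := Nat.cast_nonneg n
        linarith)]
      have : ∀ y : ℝ, F (x₁ + y * Complex.I) * g y =
          ((‖F (x₁ + y * Complex.I)‖ ^ 2 : ℝ) : ℂ) := by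
        intro y
        rw [hgdef, Complex.mul_conj, Complex.normSq_eq_norm_sq]
      simp_rw [this]
      rw [integral_complex_ofReal, MeasureTheory.integral_eq_lintegral_of_nonneg_ae
        (f := fun y : ℝ => ‖F (x₁ + y * Complex.I)‖ ^ 2)
        (Filter.Eventually.of_forall fun y => sq_nonneg ‖F (x₁ + y * Complex.I)‖)
        (hc₁.norm.pow 2).aestronglyMeasurable]
      congr 2
      refine MeasureTheory.lintegral_congr fun y => ?_
      rw [ENNReal.ofReal_pow (norm_nonneg _), ofReal_norm]
    rw [hval, Complex.norm_real, Real.norm_of_nonneg ENNReal.toReal_nonneg,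
      ENNReal.toReal_le_toReal hAtop
        (ENNReal.mul_ne_top (half_ne _ (hL x₀ h₀)) (half_ne A hAtop))] at hPL
    by_cases hA0 : A = 0
    · rw [hA0]
      exact bot_le
    have hAA : A = A ^ (1 / 2 : ℝ) * A ^ (1 / 2 : ℝ) := by
      rw [← ENNReal.rpow_add _ _ hA0 hAtop]
      norm_num
    have hA12 : A ^ (1 / 2 : ℝ) ≠ 0 := by
      simp [ENNReal.rpow_eq_zero_iff, hA0]
    have hPL' : A ^ (1 / 2 : ℝ) * A ^ (1 / 2 : ℝ) ≤
        lineSq F x₀ ^ (1 / 2 : ℝ) * A ^ (1 / 2 : ℝ) := hAA ▸ hPL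
    have h2 := (ENNReal.mul_le_mul_iff_left hA12 (half_ne A hAtop)).1 hPL'
    exact (ENNReal.rpow_le_rpow_iff (by norm_num)).1 h2
  have hmono : Monotone fun n : ℕ => Set.Ioc (-(n : ℝ)) n := by
    intro m n hmn
    have : (m : ℝ) ≤ n := by exact_mod_cast hmn
    exact Set.Ioc_subset_Ioc (by linarith) this
  have hU : ⋃ n : ℕ, Set.Ioc (-(n : ℝ)) n = Set.univ := by
    refine Set.eq_univ_of_forall fun y => Set.mem_iUnion.2 ?_
    obtain ⟨n, hn⟩ := exists_nat_gt |y|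
    exact ⟨n, (abs_lt.1 hn).1, (abs_lt.1 hn).2.le⟩
  rw [show lineSq F x₁ = ∫⁻ y in ⋃ n : ℕ, Set.Ioc (-(n : ℝ)) n, ‖F (x₁ + y * Complex.I)‖ₑ ^ 2 by
    rw [hU, MeasureTheory.setLIntegral_univ, lineSq]]
  rw [MeasureTheory.setLIntegral_iUnion_of_directed _ hmono.directed_le]
  exact iSup_le key

namespace HardyH2

lemma lineSq_anti (f : HardyH2) {x₀ x₁ : ℝ} (h₀ : 0 < x₀) (h : x₀ ≤ x₁) :
    lineSq (zeroExt f.toFun) x₁ ≤ lineSq (zeroExt f.toFun) x₀ :=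
  lineSq_antitone f.hol (ENNReal.mul_ne_top ENNReal.ofReal_ne_top f.hardySq_ne_top)
    (fun _ hx => lineSq_le f.toFun hx) h₀ h

lemma lineSq_parallelogram (f g : HardyH2) {x : ℝ} (hx : 0 < x) :
    lineSq (zeroExt (f + g).toFun) x + lineSq (zeroExt (f - g).toFun) x =
      2 * (lineSq (zeroExt f.toFun) x + lineSq (zeroExt g.toFun) x) := by
  have hm : ∀ h : HardyH2, Measurable fun y : ℝ =>
      ‖zeroExt h.toFun (x + y * Complex.I)‖ₑ ^ 2 := fun h =>
    (continuous_line h.hol hx).measurable.enorm.pow_const 2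
  unfold lineSq
  rw [← MeasureTheory.lintegral_add_left (hm (f + g)), ← MeasureTheory.lintegral_add_left (hm f),
    ← MeasureTheory.lintegral_const_mul' _ _ (by norm_num)]
  refine MeasureTheory.lintegral_congr fun y => ?_
  rw [coe_add, coe_sub, zeroExt_add, zeroExt_sub, Pi.add_apply, Pi.sub_apply]
  have e : ∀ c : ℂ, ‖c‖ₑ ^ 2 = ENNReal.ofReal (‖c‖ * ‖c‖) := by
    intro c
    rw [← pow_two, ENNReal.ofReal_pow (norm_nonneg _), ofReal_norm]
  simp only [e]
  rw [← ENNReal.ofReal_add (by positivity) (by positivity),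
    ← ENNReal.ofReal_add (by positivity) (by positivity), parallelogram_law_with_norm_mul ℂ,
    ENNReal.ofReal_mul (by norm_num)]
  simp

lemma hardySq_parallelogram (f g : HardyH2) :
    hardySq (f + g).toFun + hardySq (f - g).toFun = 2 * (hardySq f.toFun + hardySq g.toFun) := by
  have anti : ∀ (h : HardyH2) (i k : Set.Ioi (0 : ℝ)), k ≤ i →
      ENNReal.ofReal (1 / Real.pi) * lineSq (zeroExt h.toFun) i ≤
        ENNReal.ofReal (1 / Real.pi) * lineSq (zeroExt h.toFun) k := by
    intro h i k hki
    gcongr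
    exact h.lineSq_anti k.2 hki
  have sup_add : ∀ u v : HardyH2, hardySq u.toFun + hardySq v.toFun =
      ⨆ x : Set.Ioi (0 : ℝ), (ENNReal.ofReal (1 / Real.pi) * lineSq (zeroExt u.toFun) x +
        ENNReal.ofReal (1 / Real.pi) * lineSq (zeroExt v.toFun) x) := by
    intro u v
    refine ENNReal.iSup_add_iSup fun i j => ⟨min i j, ?_⟩
    exact add_le_add (anti u _ _ (min_le_left i j)) (anti v _ _ (min_le_right i j))
  rw [sup_add, sup_add, ENNReal.mul_iSup]
  refine iSup_congr fun x => ?_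
  rw [← mul_add, ← mul_add, lineSq_parallelogram f g x.2, mul_left_comm]

/-- The inner product that induces the Hardy norm. -/
instance : InnerProductSpace ℂ HardyH2 :=
  InnerProductSpace.ofNorm ℂ fun f g => by
    simp only [norm_mul_self]
    have h := congrArg ENNReal.toReal (hardySq_parallelogram f g)
    rw [ENNReal.toReal_add (hardySq_ne_top _) (hardySq_ne_top _), ENNReal.toReal_mul,
      ENNReal.toReal_add (hardySq_ne_top _) (hardySq_ne_top _)] at h
    simpa using h

end HardyH2

/-! Point evaluations are bounded, and the space is complete -/

lemma measurable_zeroExt {f : RightHalfPlane → ℂ} (hf : IsHolomorphic f) :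
    Measurable (zeroExt f) := by
  refine (MeasurableEmbedding.subtype_coe
    isOpen_rightHalfPlane.measurableSet).measurable_extend ?_ measurable_const
  have : f = fun w : RightHalfPlane => zeroExt f w := by
    funext w
    rw [zeroExt_apply]
  rw [this]
  exact (continuousOn_iff_continuous_domRestrict.1 hf.continuousOn).measurable

lemma circle_bound {F : ℂ → ℂ} (hF : DifferentiableOn ℂ F RightHalfPlane) {c : ℂ} {ρ : ℝ}
    (hρ : 0 < ρ) (hc : ρ < c.re) :
    ENNReal.ofReal (2 * Real.pi) * ‖F c‖ₑ ^ 2 ≤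
      ∫⁻ θ in Set.Ioo (-Real.pi) Real.pi,
        ‖F (c + Complex.polarCoord.symm (ρ, θ))‖ₑ ^ 2 := by
  have hsub : Metric.closedBall c ρ ⊆ RightHalfPlane := by
    intro z hz
    have h1 : |(z - c).re| ≤ ρ :=
      (Complex.abs_re_le_norm _).trans (by simpa [dist_eq_norm] using hz)
    have h2 := (abs_le.1 h1).1
    rw [Complex.sub_re] at h2
    change 0 < z.re
    linarith
  have hd : DifferentiableOn ℂ (fun z => F z ^ 2) RightHalfPlane := hF.pow 2
  have hm : Real.circleAverage (fun z => F z ^ 2) c ρ = F c ^ 2 := by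
    apply DiffContOnCl.circleAverage
    apply DifferentiableOn.diffContOnCl
    refine hd.mono (Set.Subset.trans ?_ hsub)
    rw [abs_of_pos hρ]
    exact Metric.closure_ball_subset_closedBall
  rw [Real.circleAverage_eq_integral_add (-Real.pi),
    intervalIntegral.integral_comp_add_right (fun θ => F (circleMap c ρ θ) ^ 2),
    show (0 : ℝ) + -Real.pi = -Real.pi by ring, show 2 * Real.pi + -Real.pi = Real.pi by ring,
    intervalIntegral.integral_of_le (by linarith [Real.pi_pos])] at hm
  have hm2 : ((2 * Real.pi : ℝ) : ℂ) * F c ^ 2 =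
      ∫ θ in Set.Ioc (-Real.pi) Real.pi, F (circleMap c ρ θ) ^ 2 := by
    rw [← hm, Complex.real_smul, ← mul_assoc, ← Complex.ofReal_mul,
      mul_inv_cancel₀ (by positivity), Complex.ofReal_one, one_mul]
  have hm3 : ENNReal.ofReal (2 * Real.pi) * ‖F c‖ₑ ^ 2 =
      ‖∫ θ in Set.Ioc (-Real.pi) Real.pi, F (circleMap c ρ θ) ^ 2‖ₑ := by
    rw [← hm2, enorm_mul, enorm_pow, ← ofReal_norm ((2 * Real.pi : ℝ) : ℂ), Complex.norm_real,
      Real.norm_of_nonneg (by positivity)]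
  rw [hm3, MeasureTheory.restrict_Ioo_eq_restrict_Ioc]
  refine (MeasureTheory.enorm_integral_le_lintegral_enorm _).trans (le_of_eq ?_)
  refine MeasureTheory.lintegral_congr fun θ => ?_
  rw [enorm_pow]
  congr 3
  simp [circleMap, Complex.exp_mul_I]

lemma eval_bound {f : RightHalfPlane → ℂ} (hf : IsHolomorphic f) {K : ℝ≥0∞}
    (hb : ∀ x : ℝ, 0 < x → lineSq (zeroExt f) x ≤ K) {c : ℂ} {r : ℝ} (hr : 0 < r)
    (hc : r < c.re) :
    ENNReal.ofReal (r / 2) * ENNReal.ofReal (r / 2) *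
      (ENNReal.ofReal (2 * Real.pi) * ‖zeroExt f c‖ₑ ^ 2) ≤ ENNReal.ofReal (2 * r) * K := by
  set F := zeroExt f with hFdef
  have hFm : Measurable F := measurable_zeroExt hf
  set G : ℂ → ℝ≥0∞ := (Metric.ball (0 : ℂ) r).indicator fun z => ‖F (c + z)‖ₑ ^ 2 with hG
  have hGm : Measurable G :=
    ((hFm.comp (measurable_const.add measurable_id)).enorm.pow_const 2).indicator
      Metric.isOpen_ball.measurableSet
  have hpm : Measurable fun p : ℝ × ℝ => Complex.polarCoord.symm p := by
    simp only [Complex.polarCoord_symm_apply]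
    fun_prop
  have hlow : ENNReal.ofReal (r / 2) * ENNReal.ofReal (r / 2) *
      (ENNReal.ofReal (2 * Real.pi) * ‖F c‖ₑ ^ 2) ≤ ∫⁻ z, G z := by
    rw [← Complex.lintegral_comp_polarCoord_symm, polarCoord_target,
      MeasureTheory.Measure.volume_eq_prod, ← MeasureTheory.Measure.prod_restrict,
      MeasureTheory.lintegral_prod _ (by
        refine Measurable.aemeasurable ?_
        exact (ENNReal.measurable_ofReal.comp measurable_fst).smul (hGm.comp hpm))]
    calc ENNReal.ofReal (r / 2) * ENNReal.ofReal (r / 2) *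
          (ENNReal.ofReal (2 * Real.pi) * ‖F c‖ₑ ^ 2)
        = ∫⁻ ρ in Set.Ioo (r / 2) r, ENNReal.ofReal (r / 2) *
          (ENNReal.ofReal (2 * Real.pi) * ‖F c‖ₑ ^ 2) := by
          rw [MeasureTheory.setLIntegral_const, Real.volume_Ioo,
            show r - r / 2 = r / 2 by ring]
          ring
      _ ≤ ∫⁻ ρ in Set.Ioo (r / 2) r, ∫⁻ θ in Set.Ioo (-Real.pi) Real.pi,
          ENNReal.ofReal (ρ, θ).1 • G (Complex.polarCoord.symm (ρ, θ)) := by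
          refine MeasureTheory.setLIntegral_mono' measurableSet_Ioo fun ρ hρ => ?_
          have hρ0 : 0 < ρ := by linarith [hρ.1]
          simp only [smul_eq_mul]
          rw [MeasureTheory.lintegral_const_mul' _ _ ENNReal.ofReal_ne_top]
          refine mul_le_mul' (ENNReal.ofReal_le_ofReal hρ.1.le) ?_
          refine (circle_bound hf hρ0 (hρ.2.trans hc)).trans (le_of_eq ?_)
          refine MeasureTheory.lintegral_congr fun θ => ?_
          rw [hG, Set.indicator_of_mem]
          rw [mem_ball_zero_iff, Complex.norm_polarCoord_symm, abs_of_pos hρ0]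
          exact hρ.2
      _ ≤ _ := MeasureTheory.lintegral_mono_set fun ρ hρ => by
          have := hρ.1
          change 0 < ρ
          linarith
  refine hlow.trans ?_
  rw [← (Complex.volume_preserving_equiv_real_prod.symm).lintegral_comp_emb
    Complex.measurableEquivRealProd.symm.measurableEmbedding,
    MeasureTheory.Measure.volume_eq_prod,
    MeasureTheory.lintegral_prod (fun p : ℝ × ℝ => G (Complex.measurableEquivRealProd.symm p))
      (hGm.comp Complex.measurableEquivRealProd.symm.measurable).aemeasurable]
  calc ∫⁻ x : ℝ, ∫⁻ y : ℝ, G (Complex.measurableEquivRealProd.symm (x, y))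
      ≤ ∫⁻ x : ℝ, (Set.Ioo (-r) r).indicator (fun _ => K) x := by
        refine MeasureTheory.lintegral_mono fun x => ?_
        have hval : ∀ y : ℝ, Complex.measurableEquivRealProd.symm (x, y) =
            (x + y * Complex.I : ℂ) := by
          intro y
          rw [← Complex.mk_eq_add_mul_I]
          rfl
        simp only [hval]
        by_cases hx : x ∈ Set.Ioo (-r) r
        · rw [Set.indicator_of_mem hx]
          have hcx : 0 < c.re + x := by linarith [hx.1]
          refine le_trans ?_ (hb (c.re + x) hcx)
          have := lintegral_shift F (c + x)
          rw [Complex.add_re, Complex.ofReal_re] at this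
          rw [← this]
          refine MeasureTheory.lintegral_mono fun y => ?_
          rw [hG, add_assoc]
          exact Set.indicator_le_self' (fun _ _ => bot_le) _
        · rw [Set.indicator_of_notMem hx]
          refine le_of_eq ((MeasureTheory.lintegral_congr fun y => ?_).trans
            MeasureTheory.lintegral_zero)
          rw [hG, Set.indicator_of_notMem]
          intro hmem
          rw [mem_ball_zero_iff] at hmem
          have h1 := (Complex.abs_re_le_norm (x + y * Complex.I)).trans_lt hmem
          have h2 : |x| < r := by simpa using h1
          exact hx (abs_lt.1 h2)
    _ = ENNReal.ofReal (2 * r) * K := by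
        rw [MeasureTheory.lintegral_indicator measurableSet_Ioo,
          MeasureTheory.setLIntegral_const, Real.volume_Ioo, mul_comm]
        congr 2
        ring

namespace HardyH2

/-- Point evaluations are bounded, uniformly on `{Re w > δ}`. -/
lemma exists_eval_bound {δ : ℝ} (hδ : 0 < δ) :
    ∃ D : ℝ, 0 < D ∧ ∀ (h : HardyH2) (c : ℂ), δ < c.re → ‖zeroExt h.toFun c‖ ≤ D * ‖h‖ := by
  refine ⟨Real.sqrt (4 / δ), by positivity, fun h c hc => ?_⟩
  have hb := eval_bound (f := h.toFun) h.hol (fun x hx => lineSq_le h.toFun hx) hδ hc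
  rw [hardySq_eq, ← ofReal_norm (zeroExt h.toFun c), ← ENNReal.ofReal_pow (norm_nonneg _),
    ← ENNReal.ofReal_mul (by positivity), ← ENNReal.ofReal_mul (by positivity),
    ← ENNReal.ofReal_mul (by positivity), ← ENNReal.ofReal_mul (by positivity),
    ← ENNReal.ofReal_mul (by positivity), ENNReal.ofReal_le_ofReal_iff (by positivity)] at hb
  refine le_of_sq_le_sq ?_ (by positivity)
  rw [mul_pow, Real.sq_sqrt (by positivity)]
  rw [div_mul_eq_mul_div, le_div_iff₀ hδ]
  have hpos : 0 < δ * Real.pi := by positivity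
  nlinarith [hb]

/-- If `u m → g` pointwise and the `u m` are eventually close to `v`, then so is `g`. -/
lemma hardySq_le_of_tendsto {u : ℕ → HardyH2} {v : RightHalfPlane → ℂ}
    (hv : ∀ w, Filter.Tendsto (fun m => u m w) Filter.atTop (nhds (v w))) {B : ℝ≥0∞}
    (hB : ∀ᶠ m in Filter.atTop, hardySq (u m).toFun ≤ B) : hardySq v ≤ B := by
  refine iSup_le fun x => ?_
  have hx : (0 : ℝ) < x := x.2
  have h1 : lineSq (zeroExt v) x ≤ ENNReal.ofReal Real.pi * B := by
    have e : lineSq (zeroExt v) x = ∫⁻ y : ℝ, Filter.liminf (fun m =>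
        ‖zeroExt (u m).toFun (((x : ℝ) : ℂ) + y * Complex.I)‖ₑ ^ 2) Filter.atTop := by
      refine MeasureTheory.lintegral_congr fun y => ?_
      symm
      apply Filter.Tendsto.liminf_eq
      have hmem := mem_rhp hx y
      rw [zeroExt_of_mem v hmem]
      simp only [zeroExt_of_mem _ hmem]
      exact ((ENNReal.continuous_pow 2).tendsto _).comp
        ((continuous_enorm.tendsto _).comp (hv ⟨_, hmem⟩))
    rw [e]
    refine (MeasureTheory.lintegral_liminf_le fun m =>
      (continuous_line (u m).hol hx).measurable.enorm.pow_const 2).trans ?_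
    refine Filter.liminf_le_of_frequently_le' (Filter.Eventually.frequently ?_)
    filter_upwards [hB] with m hm
    refine (lineSq_le (u m).toFun hx).trans ?_
    gcongr
  calc ENNReal.ofReal (1 / Real.pi) * lineSq (zeroExt v) x
      ≤ ENNReal.ofReal (1 / Real.pi) * (ENNReal.ofReal Real.pi * B) := by gcongr
    _ = B := by
      rw [← mul_assoc, ← ENNReal.ofReal_mul (by positivity),
        one_div_mul_cancel Real.pi_ne_zero, ENNReal.ofReal_one, one_mul]

instance : CompleteSpace HardyH2 := by
  refine Metric.complete_of_cauchySeq_tendsto fun u hu => ?_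
  -- uniform Cauchy estimates
  have hunif : ∀ δ : ℝ, 0 < δ → ∀ ε : ℝ, 0 < ε → ∃ N, ∀ m ≥ N, ∀ n ≥ N, ∀ c : ℂ, δ < c.re →
      dist (zeroExt (u m).toFun c) (zeroExt (u n).toFun c) < ε := by
    intro δ hδ ε hε
    obtain ⟨D, hD, hDb⟩ := exists_eval_bound hδ
    obtain ⟨N, hN⟩ := Metric.cauchySeq_iff.1 hu (ε / D) (by positivity)
    refine ⟨N, fun m hm n hn c hc => ?_⟩
    have h1 := hDb (u m - u n) c hc
    rw [coe_sub, zeroExt_sub, Pi.sub_apply, ← dist_eq_norm, ← dist_eq_norm] at h1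
    refine h1.trans_lt ?_
    have h2 := hN m hm n hn
    rw [lt_div_iff₀ hD] at h2
    linarith
  have hlim : ∀ w : RightHalfPlane, ∃ l : ℂ,
      Filter.Tendsto (fun n => u n w) Filter.atTop (nhds l) := by
    intro w
    apply cauchySeq_tendsto_of_complete
    rw [Metric.cauchySeq_iff]
    intro ε hε
    have hw : 0 < w.1.re := w.2
    obtain ⟨N, hN⟩ := hunif (w.1.re / 2) (by linarith) ε hε
    refine ⟨N, fun m hm n hn => ?_⟩
    have := hN m hm n hn w.1 (by linarith)
    rwa [zeroExt_apply, zeroExt_apply] at this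
  choose g hg using hlim
  have hgz : ∀ c ∈ RightHalfPlane, Filter.Tendsto (fun n => zeroExt (u n).toFun c) Filter.atTop
      (nhds (zeroExt g c)) := by
    intro c hc
    simp only [zeroExt_of_mem _ hc]
    exact hg ⟨c, hc⟩
  have hghol : IsHolomorphic g := by
    refine TendstoLocallyUniformlyOn.differentiableOn (φ := Filter.atTop)
      (F := fun n => zeroExt (u n).toFun) ?_
      (Filter.Eventually.of_forall fun n => (u n).hol) isOpen_rightHalfPlane
    rw [Metric.tendstoLocallyUniformlyOn_iff]
    intro ε hε x hx
    have hx' : 0 < x.re := hx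
    obtain ⟨N, hN⟩ := hunif (x.re / 2) (by linarith) (ε / 2) (by linarith)
    refine ⟨{c | x.re / 2 < c.re}, mem_nhdsWithin_of_mem_nhds
      ((isOpen_lt continuous_const Complex.continuous_re).mem_nhds
        (show x.re / 2 < x.re by linarith)), ?_⟩
    filter_upwards [Filter.eventually_ge_atTop N] with n hn c hc
    have hc' : x.re / 2 < c.re := hc
    have hcm : c ∈ RightHalfPlane := show 0 < c.re by linarith
    have hle : dist (zeroExt g c) (zeroExt (u n).toFun c) ≤ ε / 2 := by
      refine le_of_tendsto ((hgz c hcm).dist tendsto_const_nhds) ?_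
      filter_upwards [Filter.eventually_ge_atTop N] with m hm
      exact (hN m hm n hn c hc').le
    linarith
  have hsmall : ∀ ε : ℝ, 0 < ε → ∃ N, ∀ n ≥ N,
      hardySq ((u n).toFun - g) ≤ ENNReal.ofReal (ε * ε) := by
    intro ε hε
    obtain ⟨N, hN⟩ := Metric.cauchySeq_iff.1 hu ε hε
    refine ⟨N, fun n hn => ?_⟩
    refine hardySq_le_of_tendsto (u := fun m => u n - u m)
      (fun w => tendsto_const_nhds.sub (hg w)) ?_
    filter_upwards [Filter.eventually_ge_atTop N] with m hm
    have := hN n hn m hm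
    rw [dist_eq_norm] at this
    rw [hardySq_eq]
    exact ENNReal.ofReal_le_ofReal (by gcongr)
  have hdiffmem : ∀ n, hardySq ((u n).toFun - g) < ∞ → (u n).toFun - g ∈ hardySubmodule := by
    intro n hn
    refine ⟨?_, hn⟩
    rw [IsHolomorphic, zeroExt_sub]
    exact (u n).hol.sub hghol
  have hgmem : g ∈ hardySubmodule := by
    obtain ⟨N, hN⟩ := hsmall 1 one_pos
    have h1 := hdiffmem N ((hN N le_rfl).trans_lt ENNReal.ofReal_lt_top)
    have h2 : (u N).toFun ∈ hardySubmodule :=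
      Subtype.property (p := (· ∈ hardySubmodule)) (u N)
    have h3 := hardySubmodule.sub_mem h2 h1
    rwa [sub_sub_cancel] at h3
  let G : HardyH2 := (⟨g, hgmem⟩ : hardySubmodule)
  refine ⟨G, Metric.tendsto_atTop.2 fun ε hε => ?_⟩
  obtain ⟨N, hN⟩ := hsmall (ε / 2) (by linarith)
  refine ⟨N, fun n hn => ?_⟩
  have h1 : hardySq (u n - G).toFun ≤ ENNReal.ofReal (ε / 2 * (ε / 2)) := hN n hn
  rw [hardySq_eq, ENNReal.ofReal_le_ofReal_iff (by positivity)] at h1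
  rw [dist_eq_norm]
  have h2 : ‖u n - G‖ ≤ ε / 2 := abs_le_of_sq_le_sq' (by simpa [pow_two] using h1) (by positivity) |>.2
  linarith

end HardyH2

/-! Composition operators and cohyponormality -/

/-- `T` is the (bounded) composition operator `C_φ` on `H²(ℂ₊)`: `(T f)(w) = f (φ w)`. -/
def IsCompositionOperator (φ : RightHalfPlane → RightHalfPlane) (T : HardyH2 →L[ℂ] HardyH2) :
    Prop :=
  ∀ (f : HardyH2) (w : RightHalfPlane), T f w = f (φ w)

/-- There is at most one bounded composition operator with a given symbol. -/
lemma IsCompositionOperator.unique {φ : RightHalfPlane → RightHalfPlane}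
    {S T : HardyH2 →L[ℂ] HardyH2} (hS : IsCompositionOperator φ S)
    (hT : IsCompositionOperator φ T) : S = T :=
  ContinuousLinearMap.ext fun f => HardyH2.toFun_injective <| funext fun w =>
    (hS f w).trans (hT f w).symm

/-- A bounded operator `T` on a Hilbert space is cohyponormal if `‖T x‖ ≤ ‖T* x‖` for all `x`. -/
def IsCohyponormal {H : Type*} [NormedAddCommGroup H] [InnerProductSpace ℂ H] [CompleteSpace H]
    (T : H →L[ℂ] H) : Prop :=
  ∀ x : H, ‖T x‖ ≤ ‖ContinuousLinearMap.adjoint T x‖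

/-- The self-map `w ↦ a w + b` of the right half-plane, for `a > 0` and `Re b ≥ 0`. -/
def affineSelfMap (a : ℝ) (b : ℂ) (ha : 0 < a) (hb : 0 ≤ b.re) (w : RightHalfPlane) :
    RightHalfPlane :=
  ⟨a * w + b, by
    have hw : 0 < (w : ℂ).re := w.2
    have := mul_pos ha hw
    simp only [RightHalfPlane, Set.mem_ofPred_eq, Complex.add_re, Complex.re_ofReal_mul]
    linarith⟩

end HalfPlane

end

namespace HalfPlane

open ComplexConjugate

/-! Write `S f t` for `shiftedHardySq f t`. Substitution in the line integrals gives `‖C_φ f‖² = a⁻¹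
S f (Re b)`. This makes `C_φ` bounded, and it is exact, not merely a bound.

The adjoint is again a weighted composition operator, `C_φ* = a⁻¹ C_ψ` with `ψ w = (w + conj b) / a`
(`adjoint_affineComp`), so `‖C_φ* f‖² = a⁻² · a · S f (Re b / a)`. The factors `a⁻¹` cancel, and
cohyponormality says that `S f (Re b) ≤ S f (Re b / a)` for every `f`
(`isCohyponormal_affineComp_iff`). Line integrals decrease away from the boundary, so this holds if
`Re b / a ≤ Re b`, that is, if `a ≥ 1` or `Re b = 0`. Otherwise `Re b < Re b / a`, and `1 / (1 +
w)`, for which `S` is strictly decreasing, violates it.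

The adjoint is found from the reproducing kernel, which need only be known up to a constant: `K_w z
= c / (z + conj w)`. The inner product comes from the norm by polarization, so the kernel is derived
from symmetry. The maps `a w + b` with `Re b = 0` act transitively on the half-plane and induce
multiples of unitaries, which expresses every `K_w` through `K_1`. Since `K_w z` is antiholomorphic
in `w`, the Cauchy–Riemann equation at `w = 1` becomes the differential equation `k + (z + 1) k' =
0` for `k = K_1`. -/

/-! ### Line integrals and the Hardy norm under affine substitution. -/

lemma lineSq_comp_affine (F : ℂ → ℂ) {a : ℝ} (ha : 0 < a) (b : ℂ) (x : ℝ) :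
    lineSq (fun z => F (a * z + b)) x = ENNReal.ofReal a⁻¹ * lineSq F (a * x + b.re) := by
  have e : (a * x + b : ℂ).re = a * x + b.re := by simp
  -- Translation invariance absorbs `Im b`; what remains is the dilation `y ↦ a y`, with Jacobian
  -- `a⁻¹`.
  rw [← e, ← lintegral_shift F (a * x + b), lineSq]
  have h := (Homeomorph.mulLeft₀ a ha.ne').measurableEmbedding.lintegral_map
    (μ := MeasureTheory.volume) (fun y : ℝ => ‖F ((a * x + b : ℂ) + y * Complex.I)‖ₑ ^ 2)
  simp only [Homeomorph.coe_mulLeft₀] at h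
  rw [Real.map_volume_mul_left ha.ne', MeasureTheory.lintegral_smul_measure,
    abs_of_pos (inv_pos.2 ha), smul_eq_mul] at h
  rw [h]
  refine MeasureTheory.lintegral_congr fun y => ?_
  congr 3
  push_cast
  ring

lemma zeroExt_comp_affine (f : RightHalfPlane → ℂ) {a : ℝ} {b : ℂ} (ha : 0 < a) (hb : 0 ≤ b.re)
    {z : ℂ} (hz : z ∈ RightHalfPlane) :
    zeroExt (f ∘ affineSelfMap a b ha hb) z = zeroExt f (a * z + b) := by
  rw [zeroExt_of_mem _ hz]
  exact (zeroExt_apply f (affineSelfMap a b ha hb ⟨z, hz⟩)).symm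

/-- `sup_{t < x < ∞} (1/π) ∫ |f (x + i y)|² dy`. -/
noncomputable def shiftedHardySq (f : RightHalfPlane → ℂ) (t : ℝ) : ℝ≥0∞ :=
  ⨆ x : Set.Ioi (0 : ℝ), ENNReal.ofReal (1 / Real.pi) * lineSq (zeroExt f) (x + t)

lemma le_shiftedHardySq (f : RightHalfPlane → ℂ) {x : ℝ} (hx : 0 < x) (t : ℝ) :
    ENNReal.ofReal (1 / Real.pi) * lineSq (zeroExt f) (x + t) ≤ shiftedHardySq f t :=
  le_iSup (fun x : Set.Ioi (0 : ℝ) => ENNReal.ofReal (1 / Real.pi) * lineSq (zeroExt f) (x + t))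
    ⟨x, hx⟩

lemma shiftedHardySq_zero (f : RightHalfPlane → ℂ) : shiftedHardySq f 0 = hardySq f := by
  simp only [shiftedHardySq, hardySq, add_zero]

lemma shiftedHardySq_le (f : RightHalfPlane → ℂ) {t : ℝ} (ht : 0 ≤ t) :
    shiftedHardySq f t ≤ hardySq f :=
  iSup_le fun x => le_iSup
    (fun x : Set.Ioi (0 : ℝ) => ENNReal.ofReal (1 / Real.pi) * lineSq (zeroExt f) x)
    ⟨x + t, add_pos_of_pos_of_nonneg x.2 ht⟩

/-- The map `x ↦ a x + Re b` carries `(0, ∞)` onto `(Re b, ∞)`, so the two suprema range over the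
same lines, up to the Jacobian `a⁻¹`. -/
lemma hardySq_comp_affine (f : RightHalfPlane → ℂ) {a : ℝ} {b : ℂ} (ha : 0 < a)
    (hb : 0 ≤ b.re) :
    hardySq (f ∘ affineSelfMap a b ha hb) = ENNReal.ofReal a⁻¹ * shiftedHardySq f b.re := by
  have hline : ∀ x : Set.Ioi (0 : ℝ),
      ENNReal.ofReal (1 / Real.pi) * lineSq (zeroExt (f ∘ affineSelfMap a b ha hb)) x =
      ENNReal.ofReal a⁻¹ *
        (ENNReal.ofReal (1 / Real.pi) * lineSq (zeroExt f) (a * x + b.re)) := by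
    intro x
    rw [mul_left_comm, ← lineSq_comp_affine (zeroExt f) ha b x]
    congr 1
    refine MeasureTheory.lintegral_congr fun y => ?_
    rw [zeroExt_comp_affine f ha hb (mem_rhp x.2 y)]
  simp only [hardySq, hline]
  rw [← ENNReal.mul_iSup]
  congr 1
  refine le_antisymm (iSup_le fun x => le_shiftedHardySq f (mul_pos ha x.2) _)
    (iSup_le fun x => le_trans (le_of_eq ?_) (le_iSup (fun x : Set.Ioi (0 : ℝ) =>
      ENNReal.ofReal (1 / Real.pi) * lineSq (zeroExt f) (a * x + b.re))
      ⟨a⁻¹ * x, mul_pos (inv_pos.2 ha) x.2⟩))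
  simp only [mul_inv_cancel_left₀ ha.ne']

lemma hardySq_comp_affine_le (f : RightHalfPlane → ℂ) {a : ℝ} {b : ℂ} (ha : 0 < a)
    (hb : 0 ≤ b.re) :
    hardySq (f ∘ affineSelfMap a b ha hb) ≤ ENNReal.ofReal a⁻¹ * hardySq f := by
  rw [hardySq_comp_affine]
  gcongr
  exact shiftedHardySq_le f hb

lemma isHolomorphic_comp_affine {f : RightHalfPlane → ℂ} (hf : IsHolomorphic f) {a : ℝ} {b : ℂ}
    (ha : 0 < a) (hb : 0 ≤ b.re) : IsHolomorphic (f ∘ affineSelfMap a b ha hb) := by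
  refine DifferentiableOn.congr (f := fun z => zeroExt f (a * z + b)) ?_
    fun z hz => zeroExt_comp_affine f ha hb hz
  exact DifferentiableOn.comp hf (by fun_prop) fun z hz => (affineSelfMap a b ha hb ⟨z, hz⟩).2

/-! ### The composition operator of an affine map. -/

/-- The composition operator of an affine self-map. -/
noncomputable def affineComp (a : ℝ) (b : ℂ) (ha : 0 < a) (hb : 0 ≤ b.re) : HardyH2 →L[ℂ] HardyH2 :=
  LinearMap.mkContinuous
    { toFun := fun f => (⟨f.toFun ∘ affineSelfMap a b ha hb,
        isHolomorphic_comp_affine f.hol ha hb,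
        (hardySq_comp_affine_le _ ha hb).trans_lt
          (ENNReal.mul_lt_top (by simp) f.hardySq_ne_top.lt_top)⟩ : hardySubmodule)
      map_add' := fun _ _ => HardyH2.toFun_injective rfl
      map_smul' := fun _ _ => HardyH2.toFun_injective rfl } (Real.sqrt a⁻¹) (by
    intro f
    rw [HardyH2.norm_def, HardyH2.norm_def, ← Real.sqrt_mul (inv_nonneg.2 ha.le)]
    refine Real.sqrt_le_sqrt ?_
    have h := ENNReal.toReal_mono (ENNReal.mul_ne_top (by simp) f.hardySq_ne_top)
      (hardySq_comp_affine_le f.toFun ha hb)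
    rwa [ENNReal.toReal_mul, ENNReal.toReal_ofReal (inv_nonneg.2 ha.le)] at h)

lemma affineComp_toFun {a : ℝ} {b : ℂ} (ha : 0 < a) (hb : 0 ≤ b.re) (f : HardyH2) :
    (affineComp a b ha hb f).toFun = f.toFun ∘ affineSelfMap a b ha hb := rfl

lemma zeroExt_affineComp {a : ℝ} {b : ℂ} (ha : 0 < a) (hb : 0 ≤ b.re) (f : HardyH2) {z : ℂ}
    (hz : z ∈ RightHalfPlane) :
    zeroExt (affineComp a b ha hb f).toFun z = zeroExt f.toFun (a * z + b) :=
  zeroExt_comp_affine f.toFun ha hb hz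

lemma isCompositionOperator_affineComp {a : ℝ} {b : ℂ} (ha : 0 < a) (hb : 0 ≤ b.re) :
    IsCompositionOperator (affineSelfMap a b ha hb) (affineComp a b ha hb) :=
  fun _ _ => rfl

/-- Elements of `H²(ℂ₊)` that agree on the half-plane are equal. -/
lemma HardyH2.ext_zeroExt {f g : HardyH2}
    (h : ∀ z ∈ RightHalfPlane, zeroExt f.toFun z = zeroExt g.toFun z) : f = g :=
  HardyH2.toFun_injective <| funext fun w => by
    simpa only [zeroExt_apply] using h w w.2

lemma norm_affineComp_sq {a : ℝ} {b : ℂ} (ha : 0 < a) (hb : b.re = 0) (f : HardyH2) :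
    ‖affineComp a b ha hb.ge f‖ ^ 2 = a⁻¹ * ‖f‖ ^ 2 := by
  rw [pow_two, pow_two, HardyH2.norm_mul_self, HardyH2.norm_mul_self, affineComp_toFun,
    hardySq_comp_affine, hb, shiftedHardySq_zero, ENNReal.toReal_mul,
    ENNReal.toReal_ofReal (inv_nonneg.2 ha.le)]

/-- Polarization of `norm_affineComp_sq`: when `Re b = 0`, the operator `√a C_φ` is isometric. -/
lemma inner_affineComp {a : ℝ} {b : ℂ} (ha : 0 < a) (hb : b.re = 0) (f g : HardyH2) :
    inner ℂ (affineComp a b ha hb.ge f) (affineComp a b ha hb.ge g) =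
      (a : ℂ)⁻¹ * inner ℂ f g := by
  rw [inner_eq_sum_norm_sq_div_four, inner_eq_sum_norm_sq_div_four]
  have h : ∀ f, (RCLike.ofReal ‖affineComp a b ha hb.ge f‖ : ℂ) ^ 2 =
      (a : ℂ)⁻¹ * (RCLike.ofReal ‖f‖ : ℂ) ^ 2 := by
    intro f
    have := congrArg (fun r : ℝ => (r : ℂ)) (norm_affineComp_sq ha hb f)
    push_cast at this
    exact this
  simp only [← map_smul, ← map_add, ← map_sub, h]
  ring

/-! ### The reproducing kernel and its explicit form. -/

/-- Evaluation at a point of the half-plane. -/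
noncomputable def evalCLM (w : RightHalfPlane) : HardyH2 →L[ℂ] ℂ :=
  LinearMap.mkContinuousOfExistsBound
    { toFun := fun f => f w
      map_add' := fun _ _ => rfl
      map_smul' := fun _ _ => rfl } (by
    have hw : 0 < w.1.re := w.2
    obtain ⟨D, -, hD⟩ := HardyH2.exists_eval_bound (half_pos hw)
    refine ⟨D, fun f => ?_⟩
    have := hD f w.1 (by linarith)
    rwa [zeroExt_apply] at this)

/-- The reproducing kernel of `H²(ℂ₊)`. -/
noncomputable def kernel (w : RightHalfPlane) : HardyH2 :=
  (InnerProductSpace.toDual ℂ HardyH2).symm (evalCLM w)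

lemma inner_kernel (w : RightHalfPlane) (f : HardyH2) : inner ℂ (kernel w) f = f w :=
  InnerProductSpace.toDual_symm_apply

lemma kernel_symm (w z : RightHalfPlane) : conj (kernel z w) = kernel w z := by
  rw [← inner_kernel, ← inner_kernel, inner_conj_symm]

/-- For `Re b = 0` the map is an automorphism of the half-plane and `√a C_φ` is unitary, so its
inverse carries kernels to multiples of kernels. -/
lemma kernel_affine {a : ℝ} {b : ℂ} (ha : 0 < a) (hb : b.re = 0) (w : RightHalfPlane) {z : ℂ}
    (hz : z ∈ RightHalfPlane) :
    zeroExt (kernel (affineSelfMap a b ha hb.ge w)).toFun z =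
      (a : ℂ)⁻¹ * zeroExt (kernel w).toFun ((z - b) / a) := by
  have hac : (a : ℂ) ≠ 0 := Complex.ofReal_ne_zero.2 ha.ne'
  have hb' : (-b / a).re = 0 := by simp [hb]
  have ha' : 0 < a⁻¹ := inv_pos.2 ha
  have key : kernel (affineSelfMap a b ha hb.ge w) =
      (a : ℂ)⁻¹ • affineComp a⁻¹ (-b / a) ha' hb'.ge (kernel w) := by
    refine ext_inner_right ℂ fun f => ?_
    -- Writing `f` as an image under the inverse composition operator puts both slots of the inner
    -- product in the form required by `inner_affineComp`.
    have hf : f = affineComp a⁻¹ (-b / a) ha' hb'.ge (affineComp a b ha hb.ge f) := by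
      refine HardyH2.ext_zeroExt fun z hz => ?_
      rw [zeroExt_affineComp _ _ _ hz, zeroExt_affineComp ha hb.ge f
        (z := (a⁻¹ : ℝ) * z + -b / a) (affineSelfMap a⁻¹ (-b / a) ha' hb'.ge ⟨z, hz⟩).2]
      congr 1
      push_cast
      field_simp
      ring
    conv_rhs => rw [hf]
    rw [inner_kernel, inner_smul_left, inner_affineComp ha' hb', inner_kernel]
    simp only [map_inv₀, Complex.conj_ofReal, Complex.ofReal_inv, inv_inv]
    rw [inv_mul_cancel_left₀ hac]
    rfl
  rw [key, HardyH2.coe_smul, zeroExt_smul, Pi.smul_apply, zeroExt_affineComp _ _ _ hz, smul_eq_mul]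
  congr 2
  push_cast
  field_simp
  ring

/-- The point `1` of the half-plane. -/
def onePt : RightHalfPlane := ⟨1, by simp [RightHalfPlane]⟩

/-- The automorphism `ζ ↦ (Re w) ζ + i Im w` sends `1` to `w`, so one kernel determines all of them.
-/
lemma kernel_eq_kernel_one {w z : ℂ} (hw : w ∈ RightHalfPlane) (hz : z ∈ RightHalfPlane) :
    zeroExt (kernel ⟨w, hw⟩).toFun z =
      (w.re : ℂ)⁻¹ * zeroExt (kernel onePt).toFun ((z - w.im * Complex.I) / w.re) := by
  have h := kernel_affine (a := w.re) (b := w.im * Complex.I) hw (by simp) onePt hz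
  rw [← h]
  congr 3
  apply Subtype.ext
  simp [affineSelfMap, onePt]

/-- For fixed `z` the left side is antiholomorphic in `w`, whereas the right side depends on `Re w`
and `Im w` separately. The tension between the two pins down the kernel. -/
lemma conj_kernel_eq {w z : ℂ} (hw : w ∈ RightHalfPlane) (hz : z ∈ RightHalfPlane) :
    conj (zeroExt (kernel ⟨z, hz⟩).toFun w) =
      (w.re : ℂ)⁻¹ * zeroExt (kernel onePt).toFun ((z - w.im * Complex.I) / w.re) := by
  rw [← kernel_eq_kernel_one hw hz, zeroExt_of_mem _ hw, zeroExt_of_mem _ hz]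
  exact kernel_symm _ _

/-- This is the Cauchy–Riemann equation in `w`, at `w = 1`, for the antiholomorphic function in
`conj_kernel_eq`. Its derivatives along `Re w` and `Im w` are computed from both sides: `h1`, `h2`
on the left, `h3`, `h4` on the right. -/
lemma kernel_one_deriv {z : ℂ} (hz : z ∈ RightHalfPlane) :
    zeroExt (kernel onePt).toFun z + (z + 1) * deriv (zeroExt (kernel onePt).toFun) z = 0 := by
  set k := zeroExt (kernel onePt).toFun with hk
  set h := zeroExt (kernel ⟨z, hz⟩).toFun with hh
  have hkd : HasDerivAt k (deriv k z) z := ((kernel onePt).hol.differentiableAt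
    (isOpen_rightHalfPlane.mem_nhds hz)).hasDerivAt
  have hhd : HasDerivAt h (deriv h 1) 1 := ((kernel ⟨z, hz⟩).hol.differentiableAt
    (isOpen_rightHalfPlane.mem_nhds onePt.2)).hasDerivAt
  have h1 : HasDerivAt (fun u : ℝ => conj (h u)) (conj (deriv h 1)) 1 := by
    have : HasDerivAt (fun u : ℝ => h u) (deriv h 1) 1 :=
      HasDerivAt.comp_ofReal (by simpa using hhd)
    exact this.star
  have h2 : HasDerivAt (fun v : ℝ => conj (h (1 + v * Complex.I)))
      (conj (deriv h 1 * Complex.I)) 0 := by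
    have e : HasDerivAt (fun v : ℂ => 1 + v * Complex.I) Complex.I ((0 : ℝ) : ℂ) := by
      simpa using ((hasDerivAt_id ((0 : ℝ) : ℂ)).mul_const Complex.I).const_add 1
    have : HasDerivAt (fun v : ℝ => h (1 + v * Complex.I)) (deriv h 1 * Complex.I) 0 :=
      (HasDerivAt.comp (h₂ := h) ((0 : ℝ) : ℂ) (by simpa using hhd) e).comp_ofReal
    exact this.star
  have h3 : HasDerivAt (fun u : ℝ => (u : ℂ)⁻¹ * k (z / u)) (-k z - z * deriv k z) 1 := by
    have i : HasDerivAt (fun u : ℂ => u⁻¹) (-1) ((1 : ℝ) : ℂ) := by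
      simpa using hasDerivAt_inv (x := (1 : ℂ)) one_ne_zero
    have e : HasDerivAt (fun u : ℂ => z / u) (z * -1) ((1 : ℝ) : ℂ) := by
      simpa only [div_eq_mul_inv] using i.const_mul z
    have c := HasDerivAt.comp (h₂ := k) (h₂' := deriv k z) ((1 : ℝ) : ℂ) (by simpa using hkd) e
    have m := (i.mul c).comp_ofReal
    refine m.congr_deriv ?_
    simp
    ring
  have h4 : HasDerivAt (fun v : ℝ => k (z - v * Complex.I)) (deriv k z * -Complex.I) 0 := by
    have e : HasDerivAt (fun v : ℂ => z - v * Complex.I) (-Complex.I) ((0 : ℝ) : ℂ) := by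
      simpa using ((hasDerivAt_id ((0 : ℝ) : ℂ)).mul_const Complex.I).const_sub z
    exact (HasDerivAt.comp (h₂ := k) ((0 : ℝ) : ℂ) (by simpa using hkd) e).comp_ofReal
  have e1 : conj (deriv h 1) = -k z - z * deriv k z := by
    refine h1.unique (h3.congr_of_eventuallyEq ?_)
    filter_upwards [lt_mem_nhds (show (0 : ℝ) < 1 from one_pos)] with u hu
    simpa using conj_kernel_eq (w := u) (by simpa [RightHalfPlane] using hu) hz
  have e2 : conj (deriv h 1 * Complex.I) = deriv k z * -Complex.I := by
    refine h2.unique (h4.congr_of_eventuallyEq (Filter.Eventually.of_forall fun v => ?_))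
    simpa using conj_kernel_eq (w := 1 + v * Complex.I) (by simp [RightHalfPlane]) hz
  rw [map_mul, Complex.conj_I] at e2
  -- Cancelling `-i` leaves `conj (h' 1) = k' z`, to be compared with `e1`.
  have e3 := mul_right_cancel₀ (neg_ne_zero.2 Complex.I_ne_zero) e2
  rw [e1] at e3
  linear_combination -e3

lemma convex_rightHalfPlane : Convex ℝ RightHalfPlane :=
  convex_halfSpace_re_gt 0

lemma add_conj_ne_zero {z w : ℂ} (hz : z ∈ RightHalfPlane) (hw : w ∈ RightHalfPlane) :
    z + conj w ≠ 0 := by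
  intro h
  have := congrArg Complex.re h
  have h1 : 0 < z.re := hz
  have h2 : 0 < w.re := hw
  simp at this
  linarith

/-- The reproducing kernel is a constant multiple of `1 / (z + conj w)`. -/
lemma exists_kernel_eq : ∃ c : ℂ, ∀ w z : RightHalfPlane,
    kernel w z = c / ((z : ℂ) + conj (w : ℂ)) := by
  set k := zeroExt (kernel onePt).toFun with hk
  have hd : ∀ z ∈ RightHalfPlane, HasDerivAt k (deriv k z) z := fun z hz =>
    ((kernel onePt).hol.differentiableAt (isOpen_rightHalfPlane.mem_nhds hz)).hasDerivAt
  -- The differential equation says that `(z + 1) k z` has derivative zero; the constant `c` is its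
  -- value.
  have hprod : ∀ z ∈ RightHalfPlane, HasDerivAt (fun z => (z + 1) * k z) 0 z := by
    intro z hz
    refine (((hasDerivAt_id z).add_const 1).mul (hd z hz)).congr_deriv ?_
    simpa using kernel_one_deriv hz
  obtain ⟨c, hc⟩ := isOpen_rightHalfPlane.exists_is_const_of_deriv_eq_zero
    convex_rightHalfPlane.isPreconnected
    (fun z hz => (hprod z hz).differentiableAt.differentiableWithinAt)
    (fun z hz => (hprod z hz).deriv)
  refine ⟨c, fun w z => ?_⟩
  have h := kernel_eq_kernel_one w.2 z.2
  have hwr : 0 < (w : ℂ).re := w.2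
  have hw0 : ((w : ℂ).re : ℂ) ≠ 0 := Complex.ofReal_ne_zero.2 hwr.ne'
  have hmem : ((z : ℂ) - (w : ℂ).im * Complex.I) / (w : ℂ).re ∈ RightHalfPlane := by
    have hzr : 0 < (z : ℂ).re := z.2
    simpa [RightHalfPlane] using div_pos hzr hwr
  have h2 := hc _ hmem
  have h3 : (w : ℂ).re * ((((z : ℂ) - (w : ℂ).im * Complex.I) / (w : ℂ).re) + 1) =
      z + conj (w : ℂ) := by
    rw [mul_add, mul_div_cancel₀ _ hw0]
    apply Complex.ext <;> simp
    ring
  rw [zeroExt_apply] at h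
  rw [eq_div_iff (add_conj_ne_zero z.2 w.2), ← h3, ← h2]
  change (kernel w).toFun z = _ at h
  rw [h, ← hk]
  field_simp

/-! ### The adjoint. -/

lemma conj_div_re_nonneg {a : ℝ} {b : ℂ} (ha : 0 < a) (hb : 0 ≤ b.re) :
    0 ≤ (conj b / a).re := by
  simpa using div_nonneg hb ha.le

/-- The adjoint of the composition operator with symbol `a w + b` is
`f ↦ a⁻¹ f ((w + conj b) / a)`. -/
lemma adjoint_affineComp {a : ℝ} {b : ℂ} (ha : 0 < a) (hb : 0 ≤ b.re) (f : HardyH2) :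
    ContinuousLinearMap.adjoint (affineComp a b ha hb) f =
      (a : ℂ)⁻¹ • affineComp a⁻¹ (conj b / a) (inv_pos.2 ha) (conj_div_re_nonneg ha hb) f := by
  obtain ⟨c, hc⟩ := exists_kernel_eq
  have hac : (a : ℂ) ≠ 0 := Complex.ofReal_ne_zero.2 ha.ne'
  refine HardyH2.toFun_injective (funext fun w => ?_)
  set w' := affineSelfMap a⁻¹ (conj b / a) (inv_pos.2 ha) (conj_div_re_nonneg ha hb) w with hw'
  -- The value of `C_φ* f` at `w` is `⟨K_w, C_φ* f⟩ = ⟨C_φ K_w, f⟩`, so only `C_φ K_w` is needed. It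
  -- is a multiple of a kernel because `a z + b + conj w = a (z + conj w')`; the constant `c` plays
  -- no role.
  have key : affineComp a b ha hb (kernel w) = (a : ℂ)⁻¹ • kernel w' := by
    refine HardyH2.toFun_injective (funext fun z => ?_)
    change kernel w (affineSelfMap a b ha hb z) = (a : ℂ)⁻¹ * kernel w' z
    rw [hc, hc, ← div_eq_inv_mul, div_div]
    congr 1
    simp only [hw', affineSelfMap, map_add, map_mul, map_div₀, Complex.conj_ofReal,
      Complex.conj_conj, Complex.ofReal_inv, map_inv₀]
    field_simp
    ring
  rw [← inner_kernel, ContinuousLinearMap.adjoint_inner_right, key, inner_smul_left, inner_kernel,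
    map_inv₀, Complex.conj_ofReal]
  rfl

/-! ### Cohyponormality as a comparison of shifted norms. -/

lemma HardyH2.norm_le_norm_iff {f g : HardyH2} :
    ‖f‖ ≤ ‖g‖ ↔ hardySq f.toFun ≤ hardySq g.toFun := by
  rw [HardyH2.norm_def, HardyH2.norm_def, Real.sqrt_le_sqrt_iff ENNReal.toReal_nonneg,
    ENNReal.toReal_le_toReal f.hardySq_ne_top g.hardySq_ne_top]

lemma isCohyponormal_affineComp_iff {a : ℝ} {b : ℂ} (ha : 0 < a) (hb : 0 ≤ b.re) :
    IsCohyponormal (affineComp a b ha hb) ↔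
      ∀ f : HardyH2, shiftedHardySq f.toFun b.re ≤ shiftedHardySq f.toFun (b.re / a) := by
  refine forall_congr' fun f => ?_
  -- On the adjoint side, the scalar `a⁻¹` contributes `a⁻²` and the dilation by `a⁻¹` contributes
  -- `a`; the product is the same factor as on the other side.
  have hinv : ‖(a : ℂ)⁻¹‖ₑ ^ 2 * ENNReal.ofReal a = ENNReal.ofReal a⁻¹ := by
    rw [← ofReal_norm, norm_inv, Complex.norm_real, Real.norm_of_nonneg ha.le,
      ← ENNReal.ofReal_pow (by positivity), ← ENNReal.ofReal_mul (by positivity)]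
    congr 1
    field_simp
  have hre : (conj b / (a : ℂ)).re = b.re / a := by simp
  rw [HardyH2.norm_le_norm_iff, adjoint_affineComp, HardyH2.coe_smul, hardySq_smul,
    affineComp_toFun, affineComp_toFun, hardySq_comp_affine, hardySq_comp_affine, inv_inv,
    ← mul_assoc, hinv, hre]
  exact ENNReal.mul_le_mul_iff_right (by simpa using ha) ENNReal.ofReal_ne_top

lemma shiftedHardySq_anti (f : HardyH2) {s t : ℝ} (hs : 0 ≤ s) (h : s ≤ t) :
    shiftedHardySq f.toFun t ≤ shiftedHardySq f.toFun s := by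
  refine iSup_mono fun x => ?_
  gcongr
  exact f.lineSq_anti (add_pos_of_pos_of_nonneg x.2 hs) (by gcongr)

/-! ### The test function `1 / (1 + w)`. -/

lemma lineSq_inv {x : ℝ} (hx : 0 < x) :
    lineSq (fun z => z⁻¹) x = ENNReal.ofReal (Real.pi / x) := by
  have h1 : lineSq (fun z => z⁻¹) 1 = ENNReal.ofReal Real.pi := by
    rw [← integral_univ_inv_one_add_sq,
      MeasureTheory.ofReal_integral_eq_lintegral_ofReal integrable_inv_one_add_sq
        (Filter.Eventually.of_forall fun y => by positivity)]
    refine MeasureTheory.lintegral_congr fun y => ?_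
    rw [← ofReal_norm, ← ENNReal.ofReal_pow (norm_nonneg _), norm_inv, inv_pow,
      ← Complex.normSq_eq_norm_sq, Complex.ofReal_one]
    congr 2
    simp [Complex.normSq_apply]
    ring
  -- The line integral of `1 / (x z)` on `Re z = 1` is computed twice: by homogeneity it is `x⁻² π`,
  -- by substitution it is `x⁻¹` times the integral sought.
  have h2 := lineSq_comp_affine (fun z => z⁻¹) hx 0 1
  have h3 : lineSq (fun z : ℂ => ((x : ℂ) * z + 0)⁻¹) 1 =
      ENNReal.ofReal (x⁻¹ ^ 2) * lineSq (fun z => z⁻¹) 1 := by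
    rw [lineSq, lineSq, ← MeasureTheory.lintegral_const_mul' _ _ ENNReal.ofReal_ne_top]
    refine MeasureTheory.lintegral_congr fun y => ?_
    rw [add_zero, mul_inv, enorm_mul, mul_pow, ← ofReal_norm (x : ℂ)⁻¹, norm_inv,
      Complex.norm_real, Real.norm_of_nonneg hx.le, ENNReal.ofReal_pow (by positivity)]
  rw [h3, h1, Complex.zero_re, add_zero, mul_one] at h2
  have hxx : ENNReal.ofReal x * ENNReal.ofReal x⁻¹ = 1 := by
    rw [← ENNReal.ofReal_mul hx.le, mul_inv_cancel₀ hx.ne', ENNReal.ofReal_one]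
  have h4 := congrArg (fun e => ENNReal.ofReal x * e) h2
  simp only [← mul_assoc, hxx, one_mul] at h4
  rw [← h4, ← ENNReal.ofReal_mul hx.le, ← ENNReal.ofReal_mul (by positivity)]
  congr 1
  field_simp

/-- The function `1 / (1 + w)` on the half-plane. -/
noncomputable def invOneAdd (w : RightHalfPlane) : ℂ := ((w : ℂ) + 1)⁻¹

lemma zeroExt_invOneAdd {z : ℂ} (hz : z ∈ RightHalfPlane) :
    zeroExt invOneAdd z = (z + 1)⁻¹ :=
  zeroExt_of_mem _ hz

lemma inv_pi_mul_lineSq_invOneAdd {x : ℝ} (hx : 0 < x) :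
    ENNReal.ofReal (1 / Real.pi) * lineSq (zeroExt invOneAdd) x =
      ENNReal.ofReal (1 / (x + 1)) := by
  have h := lineSq_comp_affine (fun z => z⁻¹) one_pos 1 x
  rw [one_mul, Complex.one_re, lineSq_inv (by positivity), inv_one, ENNReal.ofReal_one,
    one_mul] at h
  have e : lineSq (zeroExt invOneAdd) x = ENNReal.ofReal (Real.pi / (x + 1)) := by
    rw [← h]
    refine MeasureTheory.lintegral_congr fun y => ?_
    simp only [zeroExt_invOneAdd (mem_rhp hx y), Complex.ofReal_one, one_mul]
  rw [e, ← ENNReal.ofReal_mul (by positivity)]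
  congr 1
  field_simp

lemma invOneAdd_mem : invOneAdd ∈ hardySubmodule := by
  refine ⟨?_, ?_⟩
  · refine DifferentiableOn.congr (f := fun z => (z + 1)⁻¹) ?_ fun z hz => zeroExt_invOneAdd hz
    refine DifferentiableOn.inv (by fun_prop) fun z hz h => ?_
    exact add_conj_ne_zero hz onePt.2 (by simpa [onePt] using h)
  · refine (iSup_le fun x => ?_ : hardySq invOneAdd ≤ 1).trans_lt ENNReal.one_lt_top
    have hx : (0 : ℝ) < x := x.2
    rw [inv_pi_mul_lineSq_invOneAdd hx]
    refine ENNReal.ofReal_le_one.2 ?_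
    rw [div_le_one (by positivity)]
    linarith

/-- The normalized line integral at abscissa `x` is `1 / (x + 1)`, which is strictly decreasing. -/
lemma shiftedHardySq_invOneAdd_lt {s t : ℝ} (hs : 0 ≤ s) (h : s < t) :
    shiftedHardySq invOneAdd t < shiftedHardySq invOneAdd s := by
  have h1 : shiftedHardySq invOneAdd t ≤ ENNReal.ofReal (1 / (t + 1)) := by
    refine iSup_le fun x => ?_
    have hx : (0 : ℝ) < x := x.2
    rw [inv_pi_mul_lineSq_invOneAdd (by linarith)]
    refine ENNReal.ofReal_le_ofReal (one_div_le_one_div_of_le (by linarith) (by linarith))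
  -- The supremum runs over abscissas strictly greater than `s`, so the midpoint of `s` and `t`
  -- serves as a witness that keeps the inequality strict.
  have h2 := le_shiftedHardySq invOneAdd (half_pos (sub_pos.2 h)) s
  rw [inv_pi_mul_lineSq_invOneAdd (by linarith)] at h2
  refine h1.trans_lt (lt_of_lt_of_le ?_ h2)
  rw [ENNReal.ofReal_lt_ofReal_iff (by apply one_div_pos.2; linarith)]
  exact one_div_lt_one_div_of_lt (by linarith) (by linarith)

end HalfPlane

/-- By `IsCompositionOperator.unique` the operator is determined by its symbol, so the existential
speaks of `C_φ` itself. -/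
theorem mainTheorem2 (a : ℝ) (b : ℂ) (ha : 0 < a) (hb : 0 ≤ b.re) :
    ∃ C : HalfPlane.HardyH2 →L[ℂ] HalfPlane.HardyH2,
      HalfPlane.IsCompositionOperator (HalfPlane.affineSelfMap a b ha hb) C ∧
        (HalfPlane.IsCohyponormal C ↔ 1 ≤ a ∨ b.re = 0) := by
  refine ⟨HalfPlane.affineComp a b ha hb, HalfPlane.isCompositionOperator_affineComp ha hb, ?_⟩
  rw [HalfPlane.isCohyponormal_affineComp_iff]
  constructor
  · intro h
    by_contra! hc
    have hlt : b.re < b.re / a := by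
      rw [lt_div_iff₀ ha]
      exact mul_lt_of_lt_one_right (lt_of_le_of_ne hb hc.2.symm) hc.1
    exact (HalfPlane.shiftedHardySq_invOneAdd_lt hb hlt).not_ge
      (h (⟨HalfPlane.invOneAdd, HalfPlane.invOneAdd_mem⟩ : HalfPlane.hardySubmodule))
  · rintro (h | h) f
    · exact HalfPlane.shiftedHardySq_anti f (div_nonneg hb ha.le) (div_le_self hb h)
    · rw [h, zero_div]
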